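/- Let $0<q<1$, let $k,m,N\in\mathbb{N}_0$, $n\in\{0,1,\dots,N\}$, and let $\alpha,\beta\in\mathbb{R}$ satisfy $0<\alpha q<1$ and $0<\beta q<1$. Write $(a;q)_j=\prod_{i=0}^{j-1}(1-aq^i)$. For real $a,b$ let $$\tilde Q_n(\bar x;a,b,N|q)=\frac{(aq;q)_n(q^{-N};q)_n}{(abq^{n+1};q)_n}\sum_{j=0}^{n}\frac{(q^{-n};q)_j\,(abq^{n+1};q)_j\,(\bar x;q)_j}{(aq;q)_j\,(q^{-N};q)_j}\,\frac{q^j}{(q;q)_j}$$ be the monic $q$-Hahn polynomial in the variable $\bar x=q^{-x}$, and let $$w(i)=\frac{(\alpha q;q)_i\,(q^{-N};q)_i}{(q;q)_i\,(\beta^{-1}q^{-N};q)_i\,(\alpha\beta q)^i},\qquad i=0,1,\dots,N.$$ A real polynomial $Q$ is called discrete quasi-orthogonal of order $r\le n$ on $(1,q^{-N})$ with respect to $w$ if it has exact degree $n$, all weights $w(0),\dots,w(N)$ at the distinct points $q^{-i}\in[1,q^{-N}]$, $0\le i\le N$, are positive, and $$\sum_{i=0}^{N}(q^{-i})^{s}\,Q(q^{-i})\,w(i)\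 \begin{cases}=0,& s\in\{0,1,\dots,n-r-1\},\\ \neq 0,& s=n-r.\end{cases}$$ Then: (i) if $\alpha>1$ and $k\le n-1$, then $\tilde Q_n(\bar x;\alpha/q^k,\beta,N|q)$ is discrete quasi-orthogonal of order $k$ on $(1,q^{-N})$ with respect to $w$, and has at least $n-k$ real, distinct zeros in $(1,q^{-N})$; (ii) if $\beta>1$ and $m\le n-1$, then $\tilde Q_n(\bar x;\alpha,\beta/q^m,N|q)$ is discrete quasi-orthogonal of order $m$ on $(1,q^{-N})$ with respect to $w$, and has at least $n-m$ real, distinct zeros in $(1,q^{-N})$; (iii) if $\alpha,\beta>1$ and $k+m\le n-1$, then $\tilde Q_n(\bar x;\alpha/q^k,\beta/q^m,N|q)$ is discrete quasi-orthogonal of order $k+m$ on $(1,q^{-N})$ with respect to $w$, and has at least $n-(k+m)$ real, distinct zeros in $(1,q^{-N})$. -/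

import Mathlib

open Polynomial Finset

noncomputable section

namespace QHahn

/-- The `q`-Pochhammer symbol `(a; q)_m = ∏_{j=0}^{m-1} (1 - a q^j)`. -/
def qPoch (a q : ℝ) (m : ℕ) : ℝ := ∏ j ∈ range m, (1 - a * q ^ j)

/-- The `q`-Pochhammer symbol `(X; q)_m` of the indeterminate, as a real polynomial. -/
def qPochX (q : ℝ) (m : ℕ) : ℝ[X] := ∏ j ∈ range m, (1 - X * C (q ^ j))

/-- The basic hypergeometric series `_rφ_s(a_1, …, a_r; b_1, …, b_s; q; z)`. -/
def qHyp (as bs : List ℝ) (q z : ℝ) : ℝ :=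
  ∑' m : ℕ, (as.map fun a => qPoch a q m).prod / (bs.map fun b => qPoch b q m).prod *
    ((-1) ^ m * q ^ m.choose 2) ^ (1 + (bs.length : ℤ) - (as.length : ℤ)) *
    (z ^ m / qPoch q q m)

/-- The monic `q`-Hahn polynomial `Q̃_n(x̄; α, β, N | q)` as a polynomial in `x̄ = q^{-x}`:
`(αq;q)_n (q^{-N};q)_n / (αβq^{n+1};q)_n` times
`_3φ_2(q^{-n}, αβq^{n+1}, x̄; αq, q^{-N}; q; q)`.
The series stops at the index `n` because `(q^{-n};q)_j = 0` for `j > n`. -/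
def qHahn (q α β : ℝ) (N n : ℕ) : ℝ[X] :=
  C (qPoch (α * q) q n * qPoch (q ^ (-(N : ℤ))) q n / qPoch (α * β * q ^ (n + 1)) q n) *
    ∑ j ∈ range (n + 1),
      C (qPoch (q ^ (-(n : ℤ))) q j * qPoch (α * β * q ^ (n + 1)) q j /
          (qPoch (α * q) q j * qPoch (q ^ (-(N : ℤ))) q j) * (q ^ j / qPoch q q j)) *
        qPochX q j

/-- The discrete `q`-Hahn weight
`w(x) = (αq, q^{-N}; q)_x / ((q, β^{-1}q^{-N}; q)_x (αβq)^x)`, for `x = 0, 1, …, N`. -/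
def weight (q α β : ℝ) (N x : ℕ) : ℝ :=
  qPoch (α * q) q x * qPoch (q ^ (-(N : ℤ))) q x /
    (qPoch q q x * qPoch (β⁻¹ * q ^ (-(N : ℤ))) q x * (α * β * q) ^ x)

/-- The polynomial `Q` of exact degree `n` is discrete quasi-orthogonal of order `k` with respect
to the positive weights `w i` at the `M` distinct points `x i`, `0 ≤ i < M`, of the interval with
end points `a` and `b` (which may themselves be mass points). -/
structure IsDiscreteQuasiOrthogonal (Q : ℝ[X]) (n k M : ℕ) (x w : ℕ → ℝ) (a b : ℝ) : Prop where
  degree_eq : Q.degree = n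
  order_le : k ≤ n
  points_mem : ∀ i < M, x i ∈ Set.Icc a b
  points_inj : Set.InjOn x {i | i < M}
  weight_pos : ∀ i < M, 0 < w i
  sum_eq_zero : ∀ m < n - k, ∑ i ∈ range M, x i ^ m * Q.eval (x i) * w i = 0
  sum_ne_zero : ∑ i ∈ range M, x i ^ (n - k) * Q.eval (x i) * w i ≠ 0

/-- The quasi-orthogonality statement for `q`-Hahn polynomials: `Q`, of degree `n`, is
discrete quasi-orthogonal of order `k` on `(1, q^{-N})` for the `q`-Hahn weight with parameters
`α, β`, which has the `N + 1` mass points `q^{-i}`, `0 ≤ i ≤ N`. -/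
def QuasiOrthogonal (q α β : ℝ) (N : ℕ) (Q : ℝ[X]) (n k : ℕ) : Prop :=
  IsDiscreteQuasiOrthogonal Q n k (N + 1) (fun i => q ^ (-(i : ℤ))) (weight q α β N)
    1 (q ^ (-(N : ℤ)))

/-- The set of zeros of `Q` in the open interval `(1, q^{-N})`. -/
def zerosIn (q : ℝ) (N : ℕ) (Q : ℝ[X]) : Set ℝ :=
  {y | y ∈ Set.Ioo 1 (q ^ (-(N : ℤ))) ∧ Q.IsRoot y}

/-- The polynomial `qHahn` is given by the terminating basic hypergeometric series. -/
theorem eval_qHahn {q : ℝ} (hq : q ≠ 0) (α β : ℝ) (N n : ℕ) (y : ℝ) :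
    (qHahn q α β N n).eval y =
      qPoch (α * q) q n * qPoch (q ^ (-(N : ℤ))) q n / qPoch (α * β * q * q ^ n) q n *
        qHyp [q ^ (-(n : ℤ)), α * β * q ^ (n + 1), y] [α * q, q ^ (-(N : ℤ))] q q := by
  have hX : ∀ j, (qPochX q j).eval y = qPoch y q j := by
    intro j
    simp [qPochX, qPoch, eval_prod]
  have h0 : ∀ j, j ∉ range (n + 1) → qPoch (q ^ (-(n : ℤ))) q j = 0 := by
    intro j hj
    refine prod_eq_zero (i := n) (by simp at hj ⊢; omega) ?_
    rw [zpow_neg, zpow_natCast, inv_mul_cancel₀ (pow_ne_zero n hq), sub_self]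
  have hp : α * β * q * q ^ n = α * β * q ^ (n + 1) := by ring
  unfold qHyp
  rw [tsum_eq_sum (s := range (n + 1)) (by
    intro j hj
    simp only [List.map_cons, List.prod_cons, h0 j hj, zero_mul, zero_div])]
  rw [hp]
  simp only [qHahn, eval_mul, eval_C, eval_finsetSum, hX]
  congr 1
  refine sum_congr rfl fun j _ => ?_
  simp
  ring

end QHahn

end

/-!
Clearing denominators turns the weight `w` into `hahnWeight`, which makes sense for all parameters
`a` and `b`; let `L_{a,b}` be the corresponding functional on polynomials. The `q`-Vandermonde
convolution gives `L_{a,b} ((X; q)_j)` in closed form, and multiplying a polynomial by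
`(b q^{N+1} X; q)_s` only changes `b` to `b q^s`. Hence the `q`-Chu–Vandermonde formula sums
`L_{a,b} ((b q^{N+1} X; q)_s Q̃_n)` to a product, which has a zero factor for `s < n` but not for
`s = n`, so that `Q̃_n` is orthogonal with respect to `L_{a,b}`.

For `a = α / q^k` and `b = β / q^m`, the weight with parameters `α` and `β` is, on the points
`q^{-i}`, the one with parameters `a` and `b` times a polynomial of degree `k + m`, whence
quasi-orthogonality of order `k + m`. For the zeros, multiply `Q` by the linear factors of its
zeros of odd order in the interval: the product has constant sign there, so fewer than `n - r` such
factors would contradict quasi-orthogonality of order `r`.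
-/

namespace QHahn

section QSubPow

variable {R : Type*} [CommRing R]

/-- The `q`-analogue `(x - y)(x - y q) ⋯ (x - y q^{n-1})` of `(x - y)^n`, which is the homogeneous
form of the `q`-Pochhammer symbol `(a; q)_n = qSubPow q 1 a n`. -/
def qSubPow (q x y : R) (n : ℕ) : R := ∏ i ∈ range n, (x - y * q ^ i)

@[simp]
theorem qSubPow_zero (q x y : R) : qSubPow q x y 0 = 1 := prod_range_zero _

theorem qSubPow_succ (q x y : R) (n : ℕ) :
    qSubPow q x y (n + 1) = qSubPow q x y n * (x - y * q ^ n) :=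
  prod_range_succ _ _

theorem qSubPow_add (q x y : R) (m n : ℕ) :
    qSubPow q x y (m + n) = qSubPow q x y m * qSubPow q x (y * q ^ m) n := by
  simp only [qSubPow, prod_range_add, pow_add, mul_assoc]

theorem qSubPow_succ' (q x y : R) (n : ℕ) :
    qSubPow q x y (n + 1) = (x - y) * qSubPow q x (y * q) n := by
  simp [add_comm n, qSubPow_add, qSubPow_succ]

theorem pow_mul_qSubPow (q c x y : R) (n : ℕ) :
    c ^ n * qSubPow q x y n = qSubPow q (c * x) (c * y) n := by
  simp only [qSubPow, mul_assoc, ← mul_sub, prod_mul_distrib, prod_const, card_range]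

theorem qSubPow_reverse (q x y : R) (n : ℕ) :
    q ^ n.choose 2 * qSubPow q x (y * q) n = (-1) ^ n * qSubPow q (y * q ^ n) x n := by
  induction n generalizing x with
  | zero => simp
  | succ n ih =>
    have hscale := pow_mul_qSubPow q q (y * q ^ n) x n
    rw [qSubPow_succ, qSubPow_succ', Nat.choose_succ_succ' n 1, Nat.choose_one_right, pow_add,
      mul_comm x q, show y * q ^ (n + 1) = q * (y * q ^ n) by ring, ← hscale]
    linear_combination q ^ n * (x - y * q * q ^ n) * ih x

theorem eval_qSubPow (q : R) (f g : R[X]) (t : R) (n : ℕ) :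
    (qSubPow (C q) f g n).eval t = qSubPow q (f.eval t) (g.eval t) n := by
  simp [qSubPow, eval_prod]

theorem qSubPow_eq_zero {q x y : R} {i n : ℕ} (hi : i < n) (h : x = y * q ^ i) :
    qSubPow q x y n = 0 :=
  prod_eq_zero (mem_range.2 hi) (sub_eq_zero.2 h)

theorem qSubPow_ne_zero [IsDomain R] {q x y : R} {n : ℕ} (h : ∀ i < n, x ≠ y * q ^ i) :
    qSubPow q x y n ≠ 0 :=
  prod_ne_zero_iff.2 fun i hi => sub_ne_zero.2 (h i (mem_range.1 hi))

theorem qSubPow_ne_zero_of_le {q x y : R} {m n : ℕ} (hmn : m ≤ n) (h : qSubPow q x y n ≠ 0) :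
    qSubPow q x y m ≠ 0 := by
  obtain ⟨d, rfl⟩ := Nat.exists_eq_add_of_le hmn
  exact left_ne_zero_of_mul (qSubPow_add q x y m d ▸ h)

theorem qSubPow_one_pos [LinearOrder R] [IsStrictOrderedRing R] {q a : R} (hq0 : 0 ≤ q)
    (hq1 : q ≤ 1) (ha0 : 0 ≤ a) (ha1 : a < 1) (n : ℕ) : 0 < qSubPow q 1 a n :=
  prod_pos fun _ _ => sub_pos.2 <|
    mul_lt_one_of_nonneg_of_lt_one_left ha0 ha1 (pow_le_one₀ hq0 hq1)

theorem pow_mul_qSubPow_one_inv {K : Type*} [Field K] {q b : K} (hq : q ≠ 0) (hb : b ≠ 0)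
    (i j : ℕ) :
    (b * q ^ (i + j)) ^ i * qSubPow q 1 (b * q ^ (i + j))⁻¹ i =
      (-1) ^ i * q ^ i.choose 2 * qSubPow q 1 (b * q ^ j * q) i := by
  rw [pow_mul_qSubPow, mul_one, mul_inv_cancel₀ (mul_ne_zero hb (pow_ne_zero _ hq)), mul_assoc,
    qSubPow_reverse, ← mul_assoc, ← mul_pow, neg_one_mul, neg_neg, one_pow, one_mul,
    mul_assoc b, ← pow_add, add_comm j]

end QSubPow

section QBinom

variable {R : Type*} [CommRing R]

/-- The Gaussian binomial coefficient, defined by Pascal's rule so that it makes sense for every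
`q`, including roots of unity. -/
def qBinom (q : R) : ℕ → ℕ → R
  | _, 0 => 1
  | 0, _ + 1 => 0
  | n + 1, k + 1 => q ^ (k + 1) * qBinom q n (k + 1) + qBinom q n k

@[simp]
theorem qBinom_zero_right (q : R) (n : ℕ) : qBinom q n 0 = 1 := by
  cases n <;> rfl

theorem qBinom_succ_succ (q : R) (n k : ℕ) :
    qBinom q (n + 1) (k + 1) = q ^ (k + 1) * qBinom q n (k + 1) + qBinom q n k := rfl

theorem qBinom_eq_zero_of_lt (q : R) {n k : ℕ} (h : n < k) : qBinom q n k = 0 := by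
  induction n generalizing k with
  | zero => obtain ⟨k, rfl⟩ := Nat.exists_eq_succ_of_ne_zero h.ne'; rfl
  | succ n ih =>
    obtain ⟨k, rfl⟩ := Nat.exists_eq_succ_of_ne_zero (Nat.ne_zero_of_lt h)
    rw [qBinom_succ_succ, ih (by omega), ih (by omega), mul_zero, add_zero]

theorem qBinom_pos [PartialOrder R] [IsStrictOrderedRing R] {q : R} (hq : 0 < q) {n k : ℕ}
    (hk : k ≤ n) : 0 < qBinom q n k := by
  induction n generalizing k with
  | zero => simp [Nat.le_zero.1 hk]
  | succ n ih =>
    obtain _ | k := k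
    · simp
    rw [qBinom_succ_succ]
    obtain rfl | hlt := (Nat.le_of_succ_le_succ hk).eq_or_lt
    · simp [qBinom_eq_zero_of_lt q (Nat.lt_succ_self k), ih le_rfl]
    · exact add_pos (mul_pos (pow_pos hq _) (ih hlt)) (ih hlt.le)

theorem qBinom_succ_succ_mul (q : R) (n k : ℕ) :
    qBinom q (n + 1) (k + 1) * (1 - q ^ (k + 1)) = (1 - q ^ (n + 1)) * qBinom q n k := by
  induction n generalizing k with
  | zero => cases k <;> simp [qBinom, mul_comm]
  | succ n ih =>
    cases k with
    | zero =>
      rw [qBinom_succ_succ, qBinom_zero_right]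
      linear_combination q * ih 0 + q * (1 - q ^ (n + 1)) * qBinom_zero_right q n
    | succ k =>
      rw [qBinom_succ_succ q (n + 1)]
      linear_combination q ^ (k + 2) * ih (k + 1) + q * ih k -
        q * (1 - q ^ (n + 1)) * qBinom_succ_succ q n k

theorem qBinom_add_mul_qSubPow (q : R) (i j : ℕ) :
    qBinom q (i + j) i * qSubPow q 1 q i = qSubPow q 1 (q ^ j * q) i := by
  induction i with
  | zero => simp
  | succ i ih =>
    rw [qSubPow_succ, qSubPow_succ, ← ih, show i + 1 + j = i + j + 1 by ring]
    linear_combination qSubPow q 1 q i * qBinom_succ_succ_mul q (i + j) i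

theorem sum_antidiagonal_qBinom_succ_mul (q : R) (n : ℕ) (f : ℕ → ℕ → R) :
    ∑ p ∈ antidiagonal (n + 1), qBinom q (n + 1) p.1 * f p.1 p.2 =
      ∑ p ∈ antidiagonal n, qBinom q n p.1 * (q ^ p.1 * f p.1 (p.2 + 1) + f (p.1 + 1) p.2) := by
  have hshift : ∑ p ∈ antidiagonal n, qBinom q n p.1 * (q ^ p.1 * f p.1 (p.2 + 1)) =
      f 0 (n + 1) +
        ∑ p ∈ antidiagonal n, qBinom q n (p.1 + 1) * (q ^ (p.1 + 1) * f (p.1 + 1) p.2) := by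
    have h := Nat.sum_antidiagonal_succ' (n := n)
      (f := fun p : ℕ × ℕ => qBinom q n p.1 * (q ^ p.1 * f p.1 p.2))
    rw [Nat.sum_antidiagonal_succ] at h
    simpa [qBinom_eq_zero_of_lt q (Nat.lt_succ_self n)] using h.symm
  simp only [mul_add, sum_add_distrib]
  rw [hshift, Nat.sum_antidiagonal_succ, add_assoc, ← sum_add_distrib, qBinom_zero_right, one_mul]
  congr 1
  exact sum_congr rfl fun p _ => by rw [qBinom_succ_succ]; ring

theorem sum_antidiagonal_qVandermonde (q x y z : R) (n : ℕ) :
    ∑ p ∈ antidiagonal n, qBinom q n p.1 * (qSubPow q x y p.1 * qSubPow q y z p.2) =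
      qSubPow q x z n := by
  induction n with
  | zero => simp
  | succ n ih =>
    rw [sum_antidiagonal_qBinom_succ_mul q n fun i j => qSubPow q x y i * qSubPow q y z j,
      qSubPow_succ, ← ih, sum_mul]
    refine sum_congr rfl fun p hp => ?_
    rw [← mem_antidiagonal.1 hp, qSubPow_succ, qSubPow_succ]
    ring

theorem sum_antidiagonal_qVandermonde_swap (q x y z : R) (n : ℕ) :
    ∑ p ∈ antidiagonal n, qBinom q n p.1 * (qSubPow q x y p.2 * qSubPow q y z p.1) =
      qSubPow q x z n := by
  induction n generalizing y z with
  | zero => simp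
  | succ n ih =>
    rw [sum_antidiagonal_qBinom_succ_mul q n fun i j => qSubPow q x y j * qSubPow q y z i,
      qSubPow_succ', ← sub_add_sub_cancel x y z, add_mul]
    nth_rewrite 1 [← ih (y * q) (z * q)]
    rw [← ih y (z * q), mul_sum, mul_sum, ← sum_add_distrib]
    refine sum_congr rfl fun p _ => ?_
    have hscale := pow_mul_qSubPow q q y z p.1
    rw [mul_comm q y, mul_comm q z] at hscale
    rw [qSubPow_succ', qSubPow_succ', ← hscale]
    ring

theorem choose_two_add_add (i j : ℕ) :
    (i + j).choose 2 + i.choose 2 + i = (i + j) * i + j.choose 2 := by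
  induction i with
  | zero => simp
  | succ i ih =>
    have hchoose (n : ℕ) : (n + 1).choose 2 = n + n.choose 2 := by
      rw [Nat.choose_succ_succ' n 1, Nat.choose_one_right]
    rw [Nat.add_right_comm i 1 j, hchoose, hchoose]
    linarith

section Field

variable {K : Type*} [Field K]

theorem pow_mul_qSubPow_one_inv_pow {q : K} (hq : q ≠ 0) (i j : ℕ) :
    (q ^ (i + j)) ^ i * qSubPow q 1 (q ^ (i + j))⁻¹ i =
      (-1) ^ i * q ^ i.choose 2 * (qBinom q (i + j) i * qSubPow q 1 q i) := by
  rw [qBinom_add_mul_qSubPow]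
  simpa only [one_mul] using pow_mul_qSubPow_one_inv hq one_ne_zero i j

theorem pow_choose_mul_qSubPow_div_qSubPow {q : K} (hq : q ≠ 0) {i : ℕ}
    (hi : qSubPow q 1 q i ≠ 0) (j : ℕ) :
    q ^ (i + j).choose 2 * (qSubPow q 1 (q ^ (i + j))⁻¹ i * (q ^ i / qSubPow q 1 q i)) =
      (-1) ^ i * q ^ j.choose 2 * qBinom q (i + j) i := by
  have hpow : q ^ (i + j).choose 2 * q ^ i.choose 2 * q ^ i =
      (q ^ (i + j)) ^ i * q ^ j.choose 2 := by
    rw [← pow_add, ← pow_add, choose_two_add_add, pow_add, pow_mul]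
  rw [← mul_div_assoc, ← mul_div_assoc, div_eq_iff hi]
  apply mul_left_cancel₀ (pow_ne_zero i (pow_ne_zero (i + j) hq))
  linear_combination q ^ (i + j).choose 2 * q ^ i * pow_mul_qSubPow_one_inv_pow hq i j +
    (-1) ^ i * qBinom q (i + j) i * qSubPow q 1 q i * hpow

/-- The `q`-Chu–Vandermonde sum for `₂φ₁(q^{-n}, A; C q; q, q)`, multiplied by `(C q; q)_n` so that
`C` is unrestricted. -/
theorem sum_antidiagonal_qChuVandermonde {q : K} (hq : q ≠ 0) {n : ℕ}
    (hn : qSubPow q 1 q n ≠ 0) (A C : K) :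
    ∑ p ∈ antidiagonal n, qSubPow q 1 (q ^ n)⁻¹ p.1 * (q ^ p.1 / qSubPow q 1 q p.1) *
        qSubPow q 1 A p.1 * qSubPow q 1 (C * q ^ p.1 * q) p.2 =
      qSubPow q A (C * q) n := by
  apply mul_left_cancel₀ (pow_ne_zero (n.choose 2) hq)
  rw [qSubPow_reverse, ← sum_antidiagonal_qVandermonde_swap q _ 1, mul_sum, mul_sum]
  refine sum_congr rfl fun ⟨i, j⟩ hp => ?_
  obtain rfl : i + j = n := mem_antidiagonal.1 hp
  have hcoeff := pow_choose_mul_qSubPow_div_qSubPow hq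
    (qSubPow_ne_zero_of_le (Nat.le_add_right i j) hn) j
  have hrev := qSubPow_reverse q 1 (C * q ^ i) j
  rw [mul_assoc C (q ^ i) (q ^ j), ← pow_add] at hrev
  linear_combination qSubPow q 1 A i * qSubPow q 1 (C * q ^ i * q) j * hcoeff +
    (-1) ^ i * qBinom q (i + j) i * qSubPow q 1 A i * hrev

end Field

end QBinom

section Functional

variable {K : Type*} [Field K]

/-- The `q`-Hahn weight at the point `q^{-i}`, where `i + j = N`, rescaled so as to have no
denominators; it is therefore defined for all parameters `a` and `b`. -/
def hahnWeight (q a b : K) (i j : ℕ) : K :=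
  qBinom q (i + j) i * qSubPow q 1 (a * q) i * ((a * q) ^ j * qSubPow q 1 (b * q) j)

/-- Integration of polynomials against `hahnWeight` on the points `q^{-i}`, `0 ≤ i ≤ N`. -/
noncomputable def hahnFunctional (q a b : K) (N : ℕ) : K[X] →ₗ[K] K :=
  ∑ p ∈ antidiagonal N, hahnWeight q a b p.1 p.2 • leval (q ^ p.1)⁻¹

theorem hahnFunctional_apply (q a b : K) (N : ℕ) (f : K[X]) :
    hahnFunctional q a b N f =
      ∑ p ∈ antidiagonal N, hahnWeight q a b p.1 p.2 * f.eval (q ^ p.1)⁻¹ := by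
  simp [hahnFunctional]

theorem hahnWeight_succ_mul {q : K} (hq : q ≠ 0) (a b : K) (i j : ℕ) :
    hahnWeight q a b (i + 1) j * (1 - (q ^ (i + 1))⁻¹) =
      (1 - (q ^ (i + j + 1))⁻¹) * (1 - a * q) * hahnWeight q (a * q) b i j := by
  have hbinom : qBinom q (i + j + 1) (i + 1) * (1 - (q ^ (i + 1))⁻¹) =
      (1 - (q ^ (i + j + 1))⁻¹) * q ^ j * qBinom q (i + j) i := by
    field_simp
    linear_combination -q ^ (i + j + 1) * qBinom_succ_succ_mul q (i + j) i
  rw [hahnWeight, hahnWeight, Nat.add_right_comm i 1 j, qSubPow_succ']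
  linear_combination (1 - a * q) * qSubPow q 1 (a * q * q) i *
    ((a * q) ^ j * qSubPow q 1 (b * q) j) * hbinom

theorem hahnFunctional_qSubPow {q : K} (hq : q ≠ 0) (a b : K) (s M : ℕ) :
    hahnFunctional q a b (s + M) (qSubPow (C q) 1 X s) =
      qSubPow q 1 (q ^ (s + M))⁻¹ s * qSubPow q 1 (a * q) s *
        qSubPow q 1 (a * b * q ^ (s + 2)) M := by
  simp only [hahnFunctional_apply, eval_qSubPow, eval_one, eval_X]
  induction s generalizing a with
  | zero =>
    simp only [qSubPow_zero, one_mul, mul_one, zero_add]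
    rw [← sum_antidiagonal_qVandermonde q 1 (a * q)]
    refine sum_congr rfl fun p hp => ?_
    rw [hahnWeight, mem_antidiagonal.1 hp, mul_assoc, pow_mul_qSubPow, mul_one,
      show a * q * (b * q) = a * b * q ^ 2 by ring]
  | succ s ih =>
    have hcancel (i : ℕ) : (q ^ (i + 1))⁻¹ * q = (q ^ i)⁻¹ := by
      rw [pow_succ, mul_inv, inv_mul_cancel_right₀ hq]
    have hvanish : qSubPow q 1 (q ^ 0)⁻¹ (s + 1) = 0 :=
      qSubPow_eq_zero s.succ_pos (by simp)
    rw [Nat.add_right_comm, Nat.sum_antidiagonal_succ, hvanish, mul_zero, zero_add,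
      qSubPow_succ', qSubPow_succ', hcancel,
      show a * b * q ^ (s + 1 + 2) = a * q * b * q ^ (s + 2) by ring]
    calc
      _ = ∑ p ∈ antidiagonal (s + M), (1 - (q ^ (s + M + 1))⁻¹) * (1 - a * q) *
            (hahnWeight q (a * q) b p.1 p.2 * qSubPow q 1 (q ^ p.1)⁻¹ s) := by
        refine sum_congr rfl fun p hp => ?_
        rw [qSubPow_succ', hcancel, ← mul_assoc, hahnWeight_succ_mul hq, mem_antidiagonal.1 hp,
          mul_assoc]
      _ = _ := by
        rw [← mul_sum, ih]
        ring

theorem hahnFunctional_qSubPow_one_mul {q : K} (hq : q ≠ 0) (a b : K) (N m : ℕ) (f : K[X]) :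
    hahnFunctional q a b N (qSubPow (C q) 1 (C (b * q ^ (N + 1)) * X) m * f) =
      qSubPow q 1 (b * q) m * hahnFunctional q a (b * q ^ m) N f := by
  simp only [hahnFunctional_apply, mul_sum, eval_mul, eval_qSubPow, eval_one, eval_C, eval_X]
  refine sum_congr rfl fun ⟨i, j⟩ hp => ?_
  obtain rfl : i + j = N := mem_antidiagonal.1 hp
  have hpoint : b * q ^ (i + j + 1) * (q ^ i)⁻¹ = b * q * q ^ j := by
    field_simp
    ring
  have hexchange : qSubPow q 1 (b * q) j * qSubPow q 1 (b * q * q ^ j) m =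
      qSubPow q 1 (b * q) m * qSubPow q 1 (b * q ^ m * q) j := by
    rw [← qSubPow_add, mul_right_comm b, ← qSubPow_add, add_comm j]
  rw [hpoint, hahnWeight, hahnWeight]
  linear_combination
    qBinom q (i + j) i * qSubPow q 1 (a * q) i * (a * q) ^ j * f.eval (q ^ i)⁻¹ * hexchange

theorem hahnFunctional_qSubPow_X_mul {q : K} (hq : q ≠ 0) (a b : K) (N k : ℕ) (f : K[X]) :
    q ^ (N * k) * hahnFunctional q a b N (qSubPow (C q) X (C (a * q)) k * f) =
      qSubPow q 1 (a * q) k * hahnFunctional q (a * q ^ k) b N f := by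
  simp only [hahnFunctional_apply, mul_sum, eval_mul, eval_qSubPow, eval_C, eval_X]
  refine sum_congr rfl fun ⟨i, j⟩ hp => ?_
  obtain rfl : i + j = N := mem_antidiagonal.1 hp
  have hpoint : q ^ ((i + j) * k) * qSubPow q (q ^ i)⁻¹ (a * q) k =
      (q ^ k) ^ j * qSubPow q 1 (a * q * q ^ i) k := by
    rw [add_mul, pow_add, pow_mul q i, mul_right_comm, pow_mul_qSubPow,
      mul_inv_cancel₀ (pow_ne_zero i hq), mul_comm (q ^ i)]
    ring
  have hexchange : qSubPow q 1 (a * q) i * qSubPow q 1 (a * q * q ^ i) k =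
      qSubPow q 1 (a * q) k * qSubPow q 1 (a * q ^ k * q) i := by
    rw [← qSubPow_add, mul_right_comm a, ← qSubPow_add, add_comm i]
  rw [hahnWeight, hahnWeight]
  linear_combination qBinom q (i + j) i * ((a * q) ^ j * qSubPow q 1 (b * q) j) *
    f.eval (q ^ i)⁻¹ * (qSubPow q 1 (a * q) i * hpoint + (q ^ k) ^ j * hexchange)

end Functional

section Orthogonality

theorem qPochX_eq_qSubPow (q : ℝ) (m : ℕ) : qPochX q m = qSubPow (C q) 1 X m := by
  simp [qPochX, qSubPow]

theorem qHahn_eq_sum_antidiagonal (q a b : ℝ) (N n : ℕ) :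
    qHahn q a b N n =
      C (qSubPow q 1 (a * q) n * qSubPow q 1 (q ^ N)⁻¹ n / qSubPow q 1 (a * b * q ^ (n + 1)) n) *
        ∑ p ∈ antidiagonal n,
          C (qSubPow q 1 (q ^ n)⁻¹ p.1 * qSubPow q 1 (a * b * q ^ (n + 1)) p.1 /
              (qSubPow q 1 (a * q) p.1 * qSubPow q 1 (q ^ N)⁻¹ p.1) *
              (q ^ p.1 / qSubPow q 1 q p.1)) *
            qSubPow (C q) 1 X p.1 := by
  simp only [qHahn, Nat.sum_antidiagonal_eq_sum_range_succ_mk, zpow_neg, zpow_natCast,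
    qPochX_eq_qSubPow]
  rfl

variable {q : ℝ} (hq0 : 0 < q) (hq1 : q < 1)

include hq0 hq1

theorem qSubPow_one_inv_pow_ne_zero {n N : ℕ} (hn : n ≤ N) : qSubPow q 1 (q ^ N)⁻¹ n ≠ 0 :=
  qSubPow_ne_zero fun i hi h => by
    rw [eq_inv_mul_iff_mul_eq₀ (pow_ne_zero N hq0.ne'), mul_one] at h
    exact (hi.trans_le hn).ne' (pow_right_injective₀ hq0 hq1.ne h)

theorem hahnFunctional_qHahn {a b : ℝ} {N n : ℕ} (hn : n ≤ N) (ha : qSubPow q 1 (a * q) n ≠ 0)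
    (b' : ℝ) :
    hahnFunctional q a b' N (qHahn q a b N n) =
      qSubPow q 1 (a * q) n * qSubPow q 1 (q ^ N)⁻¹ n / qSubPow q 1 (a * b * q ^ (n + 1)) n *
        (qSubPow q 1 (a * b' * q ^ (n + 2)) (N - n) *
          qSubPow q (a * b * q ^ (n + 1)) (a * b' * q ^ 2) n) := by
  rw [qHahn_eq_sum_antidiagonal, ← smul_eq_C_mul, map_smul, smul_eq_mul, map_sum,
    show a * b' * q ^ 2 = a * b' * q * q by ring,
    ← sum_antidiagonal_qChuVandermonde hq0.ne' (qSubPow_one_pos hq0.le hq1.le hq0.le hq1 n).ne'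
      (a * b * q ^ (n + 1)), mul_sum _ _ (qSubPow q 1 (a * b' * q ^ (n + 2)) (N - n))]
  congr 1
  refine sum_congr rfl fun ⟨i, j⟩ hp => ?_
  obtain rfl : i + j = n := mem_antidiagonal.1 hp
  obtain ⟨d, rfl⟩ := Nat.exists_eq_add_of_le hn
  have hi : qSubPow q 1 (a * q) i ≠ 0 := qSubPow_ne_zero_of_le (Nat.le_add_right i j) ha
  have hN : qSubPow q 1 (q ^ (i + (j + d)))⁻¹ i ≠ 0 :=
    qSubPow_one_inv_pow_ne_zero hq0 hq1 (Nat.le_add_right i (j + d))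
  rw [← smul_eq_C_mul, map_smul, smul_eq_mul, Nat.add_sub_cancel_left, add_assoc i j d,
    hahnFunctional_qSubPow hq0.ne', qSubPow_add q 1 (a * b' * q ^ (i + 2)),
    show a * b' * q ^ (i + 2) * q ^ j = a * b' * q ^ (i + j + 2) by ring,
    show a * b' * q ^ (i + 2) = a * b' * q * q ^ i * q by ring,
    div_mul_eq_mul_div, div_mul_eq_mul_div, div_eq_iff (mul_ne_zero hi hN)]
  ring

theorem hahnFunctional_qSubPow_mul_qHahn {a b : ℝ} {N n : ℕ} (hn : n ≤ N)
    (ha : qSubPow q 1 (a * q) n ≠ 0) (s : ℕ) :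
    hahnFunctional q a b N (qSubPow (C q) 1 (C (b * q ^ (N + 1)) * X) s * qHahn q a b N n) =
      qSubPow q 1 (b * q) s *
        (qSubPow q 1 (a * q) n * qSubPow q 1 (q ^ N)⁻¹ n / qSubPow q 1 (a * b * q ^ (n + 1)) n *
          (qSubPow q 1 (a * (b * q ^ s) * q ^ (n + 2)) (N - n) *
            qSubPow q (a * b * q ^ (n + 1)) (a * (b * q ^ s) * q ^ 2) n)) := by
  rw [hahnFunctional_qSubPow_one_mul hq0.ne', hahnFunctional_qHahn hq0 hq1 hn ha]

theorem hahnFunctional_qSubPow_mul_qHahn_eq_zero {a : ℝ} (b : ℝ) {N n s : ℕ} (hn : n ≤ N)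
    (ha : qSubPow q 1 (a * q) n ≠ 0) (hs : s < n) :
    hahnFunctional q a b N (qSubPow (C q) 1 (C (b * q ^ (N + 1)) * X) s * qHahn q a b N n) =
      0 := by
  have hvanish : qSubPow q (a * b * q ^ (n + 1)) (a * (b * q ^ s) * q ^ 2) n = 0 := by
    obtain ⟨d, rfl⟩ := Nat.exists_eq_add_of_lt hs
    exact qSubPow_eq_zero (i := d) (by omega) (by ring)
  rw [hahnFunctional_qSubPow_mul_qHahn hq0 hq1 hn ha, hvanish]
  simp only [mul_zero]

theorem hahnFunctional_qSubPow_mul_qHahn_ne_zero {a b : ℝ} {N n : ℕ} (hn : n ≤ N)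
    (ha0 : a ≠ 0) (hb0 : b ≠ 0) (ha : qSubPow q 1 (a * q) n ≠ 0) (hb : qSubPow q 1 (b * q) n ≠ 0)
    (hab : qSubPow q 1 (a * b * q ^ (n + 1)) (N + 1) ≠ 0) :
    hahnFunctional q a b N (qSubPow (C q) 1 (C (b * q ^ (N + 1)) * X) n * qHahn q a b N n) ≠
      0 := by
  have htail : qSubPow q 1 (a * (b * q ^ n) * q ^ (n + 2)) (N - n) ≠ 0 := by
    rw [show N + 1 = n + 1 + (N - n) by omega, qSubPow_add] at hab
    convert right_ne_zero_of_mul hab using 2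
    ring
  have hnorm : qSubPow q (a * b * q ^ (n + 1)) (a * (b * q ^ n) * q ^ 2) n ≠ 0 := by
    refine qSubPow_ne_zero fun i _ h => ?_
    have habq : a * b * q ^ (n + 1) ≠ 0 := mul_ne_zero (mul_ne_zero ha0 hb0) (pow_ne_zero _ hq0.ne')
    have hpow : q ^ (i + 1) = 1 := mul_left_cancel₀ habq (by linear_combination -h)
    exact (pow_lt_one₀ hq0.le hq1 i.succ_ne_zero).ne hpow
  rw [hahnFunctional_qSubPow_mul_qHahn hq0 hq1 hn ha]
  exact mul_ne_zero hb (mul_ne_zero (div_ne_zero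
    (mul_ne_zero ha (qSubPow_one_inv_pow_ne_zero hq0 hq1 hn))
    (qSubPow_ne_zero_of_le (by omega) hab)) (mul_ne_zero htail hnorm))

end Orthogonality

section Degree

theorem degree_qSubPow_C {R : Type*} [CommRing R] [IsDomain R] {q : R} {f g : R[X]} {n : ℕ}
    (h : ∀ i < n, (f - g * C (q ^ i)).degree = 1) : (qSubPow (C q) f g n).degree = n := by
  rw [qSubPow, degree_prod, sum_congr rfl fun i hi => by rw [← C_pow, h i (mem_range.1 hi)]]
  simp

theorem degree_qSubPow_one_C_mul_X {R : Type*} [CommRing R] [IsDomain R] {q c : R} (hq : q ≠ 0)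
    (hc : c ≠ 0) (n : ℕ) : (qSubPow (C q) 1 (C c * X) n).degree = n :=
  degree_qSubPow_C fun i _ => by
    rw [show 1 - C c * X * C (q ^ i) = C (-(c * q ^ i)) * X + C 1 by
      simp only [C_neg, C_mul, C_1]; ring]
    exact degree_linear (neg_ne_zero.2 (mul_ne_zero hc (pow_ne_zero i hq)))

theorem degree_qSubPow_X_C {R : Type*} [CommRing R] [IsDomain R] (q c : R) (n : ℕ) :
    (qSubPow (C q) X (C c) n).degree = n :=
  degree_qSubPow_C fun i _ => by rw [← C_mul, degree_X_sub_C]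

/-- The `q`-shifted powers `(c X; q)_s` as a graded sequence of polynomials. -/
noncomputable def qSubPowSequence {R : Type*} [CommRing R] [IsDomain R] {q c : R} (hq : q ≠ 0)
    (hc : c ≠ 0) : Polynomial.Sequence R where
  elems' := qSubPow (C q) 1 (C c * X)
  degree_eq' := degree_qSubPow_one_C_mul_X hq hc

theorem degree_qHahn {q a b : ℝ} (hq0 : 0 < q) (hq1 : q < 1) {N n : ℕ} (hn : n ≤ N)
    (ha : qSubPow q 1 (a * q) n ≠ 0) (hab : qSubPow q 1 (a * b * q ^ (n + 1)) n ≠ 0) :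
    (qHahn q a b N n).degree = n := by
  have hX (s : ℕ) : (qSubPow (C q) 1 X s).degree = s := by
    simpa using degree_qSubPow_one_C_mul_X hq0.ne' one_ne_zero s
  have hN := qSubPow_one_inv_pow_ne_zero hq0 hq1 hn
  have hn' := qSubPow_one_inv_pow_ne_zero hq0 hq1 (le_refl n)
  have hqq := (qSubPow_one_pos hq0.le hq1.le hq0.le hq1 n).ne'
  rw [qHahn_eq_sum_antidiagonal, degree_C_mul (div_ne_zero (mul_ne_zero ha hN) hab),
    Nat.sum_antidiagonal_eq_sum_range_succ_mk, sum_range_succ, degree_add_eq_right_of_degree_lt]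
  · rw [degree_C_mul (by positivity), hX]
  · rw [degree_C_mul (by positivity), hX]
    refine (degree_sum_le _ _).trans_lt <|
      (Finset.sup_lt_iff (WithBot.bot_lt_coe n)).2 fun i hi => ?_
    refine (degree_mul_le_of_le degree_C_le (hX i).le).trans_lt ?_
    rw [zero_add]
    exact Nat.cast_lt.2 (mem_range.1 hi)

end Degree

section Graded

variable {K : Type*} [Field K] {φ : K[X] →ₗ[K] K} {n : ℕ} {f : K[X]}

theorem map_eq_zero_of_degree_lt (E : Polynomial.Sequence K) (hE : ∀ s < n, φ (E s) = 0)
    (hf : f.degree < n) : φ f = 0 := by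
  have hspan := E.span_degreeLT (m := n) fun i _ => (leadingCoeff_ne_zero.2 (E.ne_zero i)).isUnit
  have hle : Submodule.span K (E '' Set.Iio n) ≤ LinearMap.ker φ :=
    Submodule.span_le.2 (Set.image_subset_iff.2 hE)
  exact hle (hspan ▸ mem_degreeLT.2 hf)

theorem map_ne_zero_of_degree_eq (E : Polynomial.Sequence K) (hE : ∀ s < n, φ (E s) = 0)
    (hn : φ (E n) ≠ 0) (hf : f.degree = n) : φ f ≠ 0 := by
  intro hφf
  have hf0 : f.leadingCoeff ≠ 0 := leadingCoeff_ne_zero.2 fun h => by simp [h] at hf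
  have hE0 : (E n).leadingCoeff ≠ 0 := leadingCoeff_ne_zero.2 (E.ne_zero n)
  have hdeg : (C f.leadingCoeff * E n - C (E n).leadingCoeff * f).degree < n := by
    refine (degree_sub_lt_left ?_ (mul_ne_zero (C_ne_zero.2 hf0) (E.ne_zero n)) ?_).trans_eq ?_
    · rw [degree_C_mul hf0, degree_C_mul hE0, E.degree_eq, hf]
    · rw [leadingCoeff_C_mul_of_isUnit hf0.isUnit, leadingCoeff_C_mul_of_isUnit hE0.isUnit,
        mul_comm]
    · rw [degree_C_mul hf0, E.degree_eq]
  have hcomb := map_eq_zero_of_degree_lt E hE hdeg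
  rw [← smul_eq_C_mul, ← smul_eq_C_mul, map_sub, map_smul, map_smul, hφf, smul_zero, sub_zero,
    smul_eq_zero] at hcomb
  exact hcomb.elim hf0 hn

end Graded

section Shift

variable {q a b : ℝ} {k m N n : ℕ}

theorem hahnFunctional_mul_qHahn_eq_zero (hq0 : 0 < q) (hq1 : q < 1) (hn : n ≤ N) (hb0 : b ≠ 0)
    (ha : qSubPow q 1 (a * q) n ≠ 0) {f : ℝ[X]} (hf : f.degree < n) :
    hahnFunctional q a b N (f * qHahn q a b N n) = 0 :=
  map_eq_zero_of_degree_lt (φ := hahnFunctional q a b N ∘ₗ LinearMap.mulRight ℝ (qHahn q a b N n))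
    (qSubPowSequence hq0.ne' (mul_ne_zero hb0 (pow_ne_zero (N + 1) hq0.ne')))
    (fun _ hs => hahnFunctional_qSubPow_mul_qHahn_eq_zero hq0 hq1 b hn ha hs) hf

theorem hahnFunctional_mul_qHahn_ne_zero (hq0 : 0 < q) (hq1 : q < 1) (hn : n ≤ N) (ha0 : a ≠ 0)
    (hb0 : b ≠ 0) (ha : qSubPow q 1 (a * q) n ≠ 0) (hb : qSubPow q 1 (b * q) n ≠ 0)
    (hab : qSubPow q 1 (a * b * q ^ (n + 1)) (N + 1) ≠ 0) {f : ℝ[X]} (hf : f.degree = n) :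
    hahnFunctional q a b N (f * qHahn q a b N n) ≠ 0 :=
  map_ne_zero_of_degree_eq (φ := hahnFunctional q a b N ∘ₗ LinearMap.mulRight ℝ (qHahn q a b N n))
    (qSubPowSequence hq0.ne' (mul_ne_zero hb0 (pow_ne_zero (N + 1) hq0.ne')))
    (fun _ hs => hahnFunctional_qSubPow_mul_qHahn_eq_zero hq0 hq1 b hn ha hs)
    (hahnFunctional_qSubPow_mul_qHahn_ne_zero hq0 hq1 hn ha0 hb0 ha hb hab) hf

/-- The ratio of the weights with parameters `(a q^k, b q^m)` and `(a, b)` on the points `q^{-i}`,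
`0 ≤ i ≤ N`, up to a constant factor, as a polynomial of degree `k + m`. -/
noncomputable def shiftFactor (q a b : ℝ) (N k m : ℕ) : ℝ[X] :=
  qSubPow (C q) X (C (a * q)) k * qSubPow (C q) 1 (C (b * q ^ (N + 1)) * X) m

theorem degree_shiftFactor (hq : q ≠ 0) (hb : b ≠ 0) (a : ℝ) (N k m : ℕ) :
    (shiftFactor q a b N k m).degree = (k + m : ℕ) := by
  rw [shiftFactor, degree_mul, degree_qSubPow_X_C,
    degree_qSubPow_one_C_mul_X hq (mul_ne_zero hb (pow_ne_zero _ hq)), Nat.cast_add]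

theorem hahnFunctional_shiftFactor_mul (hq : q ≠ 0) (a b : ℝ) (N k m : ℕ) (f : ℝ[X]) :
    q ^ (N * k) * hahnFunctional q a b N (shiftFactor q a b N k m * f) =
      qSubPow q 1 (a * q) k * qSubPow q 1 (b * q) m *
        hahnFunctional q (a * q ^ k) (b * q ^ m) N f := by
  rw [shiftFactor, mul_assoc, hahnFunctional_qSubPow_X_mul hq, hahnFunctional_qSubPow_one_mul hq,
    mul_assoc]

theorem hahnFunctional_shift_mul_qHahn_eq_zero (hq0 : 0 < q) (hq1 : q < 1) (hn : n ≤ N)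
    (hkm : k + m ≤ n) (hb0 : b ≠ 0) (ha : qSubPow q 1 (a * q) n ≠ 0)
    (hb : qSubPow q 1 (b * q) n ≠ 0) {f : ℝ[X]} (hf : f.degree + (k + m : ℕ) < n) :
    hahnFunctional q (a * q ^ k) (b * q ^ m) N (f * qHahn q a b N n) = 0 := by
  have hdeg : (shiftFactor q a b N k m * f).degree < n := by
    rwa [degree_mul, degree_shiftFactor hq0.ne' hb0, add_comm]
  have hshift := hahnFunctional_shiftFactor_mul hq0.ne' a b N k m (f * qHahn q a b N n)
  rw [← mul_assoc, hahnFunctional_mul_qHahn_eq_zero hq0 hq1 hn hb0 ha hdeg, mul_zero] at hshift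
  exact (mul_eq_zero.1 hshift.symm).resolve_left <| mul_ne_zero
    (qSubPow_ne_zero_of_le (by omega) ha) (qSubPow_ne_zero_of_le (by omega) hb)

theorem hahnFunctional_shift_mul_qHahn_ne_zero (hq0 : 0 < q) (hq1 : q < 1) (hn : n ≤ N)
    (ha0 : a ≠ 0) (hb0 : b ≠ 0) (ha : qSubPow q 1 (a * q) n ≠ 0)
    (hb : qSubPow q 1 (b * q) n ≠ 0) (hab : qSubPow q 1 (a * b * q ^ (n + 1)) (N + 1) ≠ 0)
    {f : ℝ[X]} (hf : f.degree + (k + m : ℕ) = n) :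
    hahnFunctional q (a * q ^ k) (b * q ^ m) N (f * qHahn q a b N n) ≠ 0 := by
  have hdeg : (shiftFactor q a b N k m * f).degree = n := by
    rwa [degree_mul, degree_shiftFactor hq0.ne' hb0, add_comm]
  have hshift := hahnFunctional_shiftFactor_mul hq0.ne' a b N k m (f * qHahn q a b N n)
  rw [← mul_assoc] at hshift
  exact right_ne_zero_of_mul <| hshift ▸ mul_ne_zero (pow_ne_zero (N * k) hq0.ne')
    (hahnFunctional_mul_qHahn_ne_zero hq0 hq1 hn ha0 hb0 ha hb hab hdeg)

end Shift

section Weight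

variable {q α β : ℝ}

theorem weight_eq_hahnWeight (hq0 : 0 < q) (hq1 : q < 1) (hα : α ≠ 0) (hβ : β ≠ 0) {i j : ℕ}
    (hb : qSubPow q 1 (β * q) (i + j) ≠ 0) :
    weight q α β (i + j) i =
      (qSubPow q 1 (β * q) (i + j) * (α * q) ^ (i + j))⁻¹ * hahnWeight q α β i j := by
  have hq := hq0.ne'
  have hqq : qSubPow q 1 q i ≠ 0 := (qSubPow_one_pos hq0.le hq1.le hq0.le hq1 i).ne'
  have hnum := pow_mul_qSubPow_one_inv_pow hq i j
  have hden := pow_mul_qSubPow_one_inv hq hβ i j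
  have hsplit := qSubPow_add q 1 (β * q) j i
  rw [add_comm j i, mul_right_comm β q] at hsplit
  have hfactor : qSubPow q 1 (β * q ^ j * q) i ≠ 0 := right_ne_zero_of_mul (hsplit ▸ hb)
  have hpow : (β * q ^ (i + j)) ^ i ≠ 0 :=
    pow_ne_zero i (mul_ne_zero hβ (pow_ne_zero (i + j) hq))
  have hden0 : qSubPow q 1 (β * q ^ (i + j))⁻¹ i ≠ 0 := by
    refine right_ne_zero_of_mul (a := (β * q ^ (i + j)) ^ i) ?_
    rw [hden]
    exact mul_ne_zero (mul_ne_zero (pow_ne_zero i (neg_ne_zero.2 one_ne_zero))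
      (pow_ne_zero (i.choose 2) hq)) hfactor
  rw [weight, zpow_neg, zpow_natCast, ← mul_inv, inv_mul_eq_div]
  change qSubPow q 1 (α * q) i * qSubPow q 1 (q ^ (i + j))⁻¹ i /
    (qSubPow q 1 q i * qSubPow q 1 (β * q ^ (i + j))⁻¹ i * (α * β * q) ^ i) = _
  rw [div_eq_div_iff (by positivity) (by positivity), hahnWeight]
  apply mul_left_cancel₀ hpow
  linear_combination qSubPow q 1 (α * q) i * (α * q) ^ (i + j) * β ^ i *
      (qSubPow q 1 (β * q) (i + j) * hnum +
        (-1) ^ i * q ^ i.choose 2 * qBinom q (i + j) i * qSubPow q 1 q i * hsplit) -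
    qBinom q (i + j) i * qSubPow q 1 (α * q) i * ((α * q) ^ j * qSubPow q 1 (β * q) j) *
      qSubPow q 1 q i * (α * β * q) ^ i * hden

theorem hahnWeight_pos (hq0 : 0 < q) (hq1 : q < 1) (hα0 : 0 < α * q) (hα1 : α * q < 1)
    (hβ0 : 0 < β * q) (hβ1 : β * q < 1) (i j : ℕ) : 0 < hahnWeight q α β i j :=
  mul_pos (mul_pos (qBinom_pos hq0 (Nat.le_add_right i j))
    (qSubPow_one_pos hq0.le hq1.le hα0.le hα1 i))
    (mul_pos (pow_pos hα0 j) (qSubPow_one_pos hq0.le hq1.le hβ0.le hβ1 j))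

theorem weight_pos (hq0 : 0 < q) (hq1 : q < 1) (hα0 : 0 < α * q) (hα1 : α * q < 1)
    (hβ0 : 0 < β * q) (hβ1 : β * q < 1) {N i : ℕ} (hi : i ≤ N) : 0 < weight q α β N i := by
  obtain ⟨j, rfl⟩ := Nat.exists_eq_add_of_le hi
  have hβ := qSubPow_one_pos hq0.le hq1.le hβ0.le hβ1 (i + j)
  rw [weight_eq_hahnWeight hq0 hq1 (left_ne_zero_of_mul hα0.ne') (left_ne_zero_of_mul hβ0.ne')
    hβ.ne']
  exact mul_pos (inv_pos.2 (mul_pos hβ (pow_pos hα0 _)))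
    (hahnWeight_pos hq0 hq1 hα0 hα1 hβ0 hβ1 i j)

theorem sum_eval_mul_weight (hq0 : 0 < q) (hq1 : q < 1) (hα : α ≠ 0) (hβ : β ≠ 0) {N : ℕ}
    (hb : qSubPow q 1 (β * q) N ≠ 0) (f : ℝ[X]) :
    ∑ i ∈ range (N + 1), f.eval (q ^ (-(i : ℤ))) * weight q α β N i =
      (qSubPow q 1 (β * q) N * (α * q) ^ N)⁻¹ * hahnFunctional q α β N f := by
  rw [hahnFunctional_apply, mul_sum, Nat.sum_antidiagonal_eq_sum_range_succ_mk]
  refine sum_congr rfl fun i hi => ?_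
  obtain ⟨j, rfl⟩ := Nat.exists_eq_add_of_le (mem_range_succ_iff.1 hi)
  rw [weight_eq_hahnWeight hq0 hq1 hα hβ hb, zpow_neg, zpow_natCast, Nat.add_sub_cancel_left]
  ring

end Weight

section Zeros

theorem exists_mul_prod_X_sub_C_eq_sq_mul {R : Type*} [CommRing R] [IsDomain R] (I : Set R)
    {Q : R[X]} (hQ : Q ≠ 0) :
    ∃ S : Finset R, (∀ y ∈ S, y ∈ I ∧ Q.IsRoot y) ∧
      ∃ T U : R[X], Q * ∏ y ∈ S, (X - C y) = T ^ 2 * U ∧ ∀ y ∈ I, ¬U.IsRoot y := by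
  classical
  induction hd : Q.natDegree using Nat.strong_induction_on generalizing Q with
  | _ d ih =>
    by_cases! hroot : ∀ r ∈ I, ¬Q.IsRoot r
    · exact ⟨∅, by simp, 1, Q, by simp, hroot⟩
    obtain ⟨r, hrI, hr⟩ := hroot
    obtain ⟨P, rfl⟩ := dvd_iff_isRoot.2 hr
    have hP : P ≠ 0 := right_ne_zero_of_mul hQ
    have hdeg : P.natDegree < d := by
      rw [← hd, natDegree_mul (X_sub_C_ne_zero r) hP, natDegree_X_sub_C]
      omega
    obtain ⟨S, hS, T, U, hTU, hU⟩ := ih _ hdeg hP rfl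
    have hS' (y : R) (hy : y ∈ S) : y ∈ I ∧ ((X - C r) * P).IsRoot y :=
      ⟨(hS y hy).1, root_mul_left_of_isRoot _ (hS y hy).2⟩
    by_cases hrS : r ∈ S
    · refine ⟨S.erase r, fun y hy => hS' y (mem_of_mem_erase hy), T, U, ?_, hU⟩
      rw [← hTU, ← mul_prod_erase S _ hrS]
      ring
    · refine ⟨insert r S, forall_mem_insert .. |>.2 ⟨⟨hrI, hr⟩, hS'⟩, (X - C r) * T, U, ?_, hU⟩
      rw [prod_insert hrS]
      linear_combination (X - C r) ^ 2 * hTU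

theorem nonneg_or_nonpos_on_Icc {f : ℝ → ℝ} (hf : Continuous f) {a b : ℝ} (hab : a ≠ b)
    (h : ∀ x ∈ Set.Ioo a b, f x ≠ 0) :
    (∀ x ∈ Set.Icc a b, 0 ≤ f x) ∨ ∀ x ∈ Set.Icc a b, f x ≤ 0 := by
  have hIoo : (∀ x ∈ Set.Ioo a b, 0 ≤ f x) ∨ ∀ x ∈ Set.Ioo a b, f x ≤ 0 := by
    by_contra! hc
    obtain ⟨⟨x, hx, hx0⟩, y, hy, hy0⟩ := hc
    obtain ⟨z, hz, hz0⟩ :=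
      isPreconnected_Ioo.intermediate_value hx hy hf.continuousOn ⟨hx0.le, hy0.le⟩
    exact h z hz hz0
  rw [← closure_Ioo hab]
  exact hIoo.imp (fun h x hx => closure_minimal h (isClosed_le continuous_const hf) hx)
    fun h x hx => closure_minimal h (isClosed_le hf continuous_const) hx

namespace IsDiscreteQuasiOrthogonal

variable {Q : ℝ[X]} {n k M : ℕ} {x w : ℕ → ℝ} {a b : ℝ}

theorem sum_eval_mul_eq_zero (h : IsDiscreteQuasiOrthogonal Q n k M x w a b) {P : ℝ[X]}
    (hP : P.natDegree < n - k) : ∑ i ∈ range M, (Q * P).eval (x i) * w i = 0 := by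
  have hexpand (i : ℕ) : (Q * P).eval (x i) * w i =
      ∑ s ∈ range (n - k), P.coeff s * (x i ^ s * Q.eval (x i) * w i) := by
    rw [eval_mul, eval_eq_sum_range' hP, mul_sum, sum_mul]
    exact sum_congr rfl fun s _ => by ring
  simp only [hexpand]
  rw [sum_comm]
  refine Finset.sum_eq_zero fun s hs => ?_
  rw [← mul_sum, h.sum_eq_zero s (mem_range.1 hs), mul_zero]

theorem exists_eval_ne_zero (h : IsDiscreteQuasiOrthogonal Q n k M x w a b) :
    ∃ i < M, Q.eval (x i) ≠ 0 := by
  by_contra! hzero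
  exact h.sum_ne_zero <| Finset.sum_eq_zero fun i hi => by
    rw [hzero i (mem_range.1 hi), mul_zero, zero_mul]

theorem eval_sq_mul_eq_zero (h : IsDiscreteQuasiOrthogonal Q n k M x w a b) (hab : a ≠ b)
    {T U : ℝ[X]} (hU : ∀ y ∈ Set.Ioo a b, ¬U.IsRoot y)
    (hsum : ∑ i ∈ range M, (T ^ 2 * U).eval (x i) * w i = 0) {i : ℕ} (hi : i < M) :
    (T ^ 2 * U).eval (x i) = 0 := by
  have hmem (j : ℕ) (hj : j ∈ range M) := h.points_mem j (mem_range.1 hj)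
  have hw (j : ℕ) (hj : j ∈ range M) := (h.weight_pos j (mem_range.1 hj)).le
  refine (mul_eq_zero.1 ?_).resolve_right (h.weight_pos i hi).ne'
  simp only [eval_mul, eval_pow] at hsum ⊢
  obtain hsign | hsign := nonneg_or_nonpos_on_Icc U.continuous hab hU
  · exact (sum_eq_zero_iff_of_nonneg fun j hj => mul_nonneg
      (mul_nonneg (sq_nonneg _) (hsign _ (hmem j hj))) (hw j hj)).1 hsum i (mem_range.2 hi)
  · exact (sum_eq_zero_iff_of_nonpos fun j hj => mul_nonpos_of_nonpos_of_nonneg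
      (mul_nonpos_of_nonneg_of_nonpos (sq_nonneg _) (hsign _ (hmem j hj))) (hw j hj)).1 hsum i
      (mem_range.2 hi)

theorem le_ncard_roots (h : IsDiscreteQuasiOrthogonal Q n k M x w a b) (hab : a ≠ b) :
    n - k ≤ {y | y ∈ Set.Ioo a b ∧ Q.IsRoot y}.ncard := by
  obtain ⟨i, hi, hQi⟩ := h.exists_eval_ne_zero
  have hQ : Q ≠ 0 := fun hQ => hQi (by rw [hQ, eval_zero])
  obtain ⟨S, hS, T, U, hTU, hU⟩ := exists_mul_prod_X_sub_C_eq_sq_mul (Set.Ioo a b) hQ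
  have hcard : #S ≤ {y | y ∈ Set.Ioo a b ∧ Q.IsRoot y}.ncard := by
    rw [← Set.ncard_coe_finset]
    exact Set.ncard_le_ncard hS ((finite_setOfPred_isRoot hQ).subset fun y hy => hy.2)
  refine le_trans ?_ hcard
  by_contra! hlt
  have hdeg : (∏ y ∈ S, (X - C y)).natDegree < n - k :=
    (natDegree_finsetProd_X_sub_C_eq_card S fun y => y).trans_lt hlt
  have hprod : (Q * ∏ y ∈ S, (X - C y)).eval (x i) = 0 := by
    rw [hTU]
    exact h.eval_sq_mul_eq_zero hab hU (hTU ▸ h.sum_eval_mul_eq_zero hdeg) hi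
  rw [eval_mul, mul_eq_zero, or_iff_right hQi, eval_prod, prod_eq_zero_iff] at hprod
  obtain ⟨y, hy, hxy⟩ := hprod
  rw [eval_sub, eval_X, eval_C, sub_eq_zero] at hxy
  exact hQi (hxy ▸ (hS y hy).2)

end IsDiscreteQuasiOrthogonal

end Zeros

theorem qSubPow_one_div_pow_mul_ne_zero {q c : ℝ} (hq0 : 0 < q) (hq1 : q < 1) (hc0 : 0 ≤ c * q)
    (hc1 : c * q < 1) {k : ℕ} (hc : ∀ i < k, c ≠ q ^ i) (n : ℕ) :
    qSubPow q 1 (c / q ^ k * q) n ≠ 0 := by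
  refine qSubPow_ne_zero fun i _ h => ?_
  have hpow : c * q ^ (i + 1) = q ^ k := by
    field_simp at h
    rw [h]
    ring
  obtain hik | hki := lt_or_ge i k
  · obtain ⟨d, rfl⟩ := Nat.exists_eq_add_of_lt hik
    refine hc d (by omega) (mul_right_cancel₀ (pow_ne_zero (i + 1) hq0.ne') ?_)
    rw [hpow]
    ring
  · obtain ⟨d, rfl⟩ := Nat.exists_eq_add_of_le hki
    have hone : c * q * q ^ d = 1 :=
      mul_left_cancel₀ (pow_ne_zero k hq0.ne') (by linear_combination hpow)
    exact (mul_lt_one_of_nonneg_of_lt_one_left hc0 hc1 (pow_le_one₀ hq0.le hq1.le)).ne hone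

theorem qSubPow_one_div_pow_mul_div_pow_pos {q α β : ℝ} (hq0 : 0 < q) (hq1 : q ≤ 1)
    (hα0 : 0 ≤ α * q) (hα1 : α * q < 1) (hβ0 : 0 ≤ β * q) (hβ1 : β * q ≤ 1) {k m n : ℕ}
    (hkm : k + m < n) (l : ℕ) :
    0 < qSubPow q 1 (α / q ^ k * (β / q ^ m) * q ^ (n + 1)) l := by
  obtain ⟨d, rfl⟩ := Nat.exists_eq_add_of_lt hkm
  have hcancel : α / q ^ k * (β / q ^ m) * q ^ (k + m + d + 1 + 1) = α * q * (β * q) * q ^ d := by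
    field_simp
    ring
  rw [hcancel]
  exact qSubPow_one_pos hq0.le hq1 (by positivity)
    (mul_lt_one_of_nonneg_of_lt_one_left (by positivity)
      (mul_lt_one_of_nonneg_of_lt_one_left hα0 hα1 hβ1) (pow_le_one₀ hq0.le hq1)) l

theorem zpow_neg_mem_Icc {q : ℝ} (hq0 : 0 < q) (hq1 : q ≤ 1) {i N : ℕ} (hi : i ≤ N) :
    q ^ (-(i : ℤ)) ∈ Set.Icc 1 (q ^ (-(N : ℤ))) := by
  simp only [zpow_neg, zpow_natCast]
  exact ⟨(one_le_inv₀ (pow_pos hq0 i)).2 (pow_le_one₀ hq0.le hq1),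
    inv_anti₀ (pow_pos hq0 N) (pow_le_pow_of_le_one hq0.le hq1 hi)⟩

theorem quasiOrthogonal_of_hahnFunctional {q α β : ℝ} (hq0 : 0 < q) (hq1 : q < 1)
    (hα0 : 0 < α * q) (hα1 : α * q < 1) (hβ0 : 0 < β * q) (hβ1 : β * q < 1) {N n r : ℕ}
    (hr : r ≤ n) {Q : ℝ[X]} (hQ : Q.degree = n)
    (hzero : ∀ s < n - r, hahnFunctional q α β N (X ^ s * Q) = 0)
    (hne : hahnFunctional q α β N (X ^ (n - r) * Q) ≠ 0) : QuasiOrthogonal q α β N Q n r := by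
  have hα : α ≠ 0 := left_ne_zero_of_mul hα0.ne'
  have hβ : β ≠ 0 := left_ne_zero_of_mul hβ0.ne'
  have hβN : qSubPow q 1 (β * q) N ≠ 0 := (qSubPow_one_pos hq0.le hq1.le hβ0.le hβ1 N).ne'
  have hmoment (s : ℕ) :
      ∑ i ∈ range (N + 1), (q ^ (-(i : ℤ))) ^ s * Q.eval (q ^ (-(i : ℤ))) * weight q α β N i =
        (qSubPow q 1 (β * q) N * (α * q) ^ N)⁻¹ * hahnFunctional q α β N (X ^ s * Q) := by
    rw [← sum_eval_mul_weight hq0 hq1 hα hβ hβN]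
    simp only [eval_mul, eval_pow, eval_X]
  exact {
    degree_eq := hQ
    order_le := hr
    points_mem := fun i hi => zpow_neg_mem_Icc hq0 hq1.le (Nat.lt_succ_iff.1 hi)
    points_inj := fun i _ j _ hij => pow_right_injective₀ hq0 hq1.ne (by simpa using hij)
    weight_pos := fun i hi => weight_pos hq0 hq1 hα0 hα1 hβ0 hβ1 (Nat.lt_succ_iff.1 hi)
    sum_eq_zero := fun s hs => by rw [hmoment, hzero s hs, mul_zero]
    sum_ne_zero := hmoment (n - r) ▸
      mul_ne_zero (inv_ne_zero (mul_ne_zero hβN (pow_ne_zero N hα0.ne'))) hne }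

theorem quasiOrthogonal_qHahn_div_pow {q α β : ℝ} (hq0 : 0 < q) (hq1 : q < 1)
    (hα0 : 0 < α * q) (hα1 : α * q < 1) (hβ0 : 0 < β * q) (hβ1 : β * q < 1) {k m N n : ℕ}
    (hn : n ≤ N) (hα : ∀ i < k, α ≠ q ^ i) (hβ : ∀ i < m, β ≠ q ^ i) (hkm : k + m < n) :
    QuasiOrthogonal q α β N (qHahn q (α / q ^ k) (β / q ^ m) N n) n (k + m) := by
  have hqk : q ^ k ≠ 0 := pow_ne_zero k hq0.ne'
  have hqm : q ^ m ≠ 0 := pow_ne_zero m hq0.ne'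
  have ha0 : α / q ^ k ≠ 0 := div_ne_zero (left_ne_zero_of_mul hα0.ne') hqk
  have hb0 : β / q ^ m ≠ 0 := div_ne_zero (left_ne_zero_of_mul hβ0.ne') hqm
  have ha := qSubPow_one_div_pow_mul_ne_zero hq0 hq1 hα0.le hα1 hα n
  have hb := qSubPow_one_div_pow_mul_ne_zero hq0 hq1 hβ0.le hβ1 hβ n
  have hab (l : ℕ) := (qSubPow_one_div_pow_mul_div_pow_pos hq0 hq1.le hα0.le hα1 hβ0.le hβ1.le
    hkm l).ne'
  have hzero (f : ℝ[X]) := hahnFunctional_shift_mul_qHahn_eq_zero hq0 hq1 hn hkm.le hb0 ha hb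
    (f := f)
  have hne (f : ℝ[X]) := hahnFunctional_shift_mul_qHahn_ne_zero hq0 hq1 hn ha0 hb0 ha hb
    (hab (N + 1)) (k := k) (m := m) (f := f)
  simp only [div_mul_cancel₀ _ hqk, div_mul_cancel₀ _ hqm] at hzero hne
  refine quasiOrthogonal_of_hahnFunctional hq0 hq1 hα0 hα1 hβ0 hβ1 hkm.le
    (degree_qHahn hq0 hq1 hn ha (hab n)) (fun s hs => hzero _ ?_) (hne _ ?_)
  · rw [degree_X_pow, ← Nat.cast_add, Nat.cast_lt]
    omega
  · rw [degree_X_pow, ← Nat.cast_add, Nat.sub_add_cancel hkm.le]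

end QHahn

theorem theorem2p6_general {q α β : ℝ} (hq0 : 0 < q) (hq1 : q < 1) (hα0 : 0 < α * q)
    (hα1 : α * q < 1) (hβ0 : 0 < β * q) (hβ1 : β * q < 1) {k m N n : ℕ} (hn : n ≤ N)
    (hα : ∀ i < k, α ≠ q ^ i) (hβ : ∀ i < m, β ≠ q ^ i) (hkm : k + m < n) :
    QHahn.QuasiOrthogonal q α β N (QHahn.qHahn q (α / q ^ k) (β / q ^ m) N n) n (k + m) ∧
      n - (k + m) ≤
        (QHahn.zerosIn q N (QHahn.qHahn q (α / q ^ k) (β / q ^ m) N n)).ncard := by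
  have h := QHahn.quasiOrthogonal_qHahn_div_pow hq0 hq1 hα0 hα1 hβ0 hβ1 hn hα hβ hkm
  refine ⟨h, h.le_ncard_roots (ne_of_lt ?_)⟩
  rw [zpow_neg, zpow_natCast, one_lt_inv₀ (pow_pos hq0 N)]
  exact pow_lt_one₀ hq0.le hq1 (by omega)

theorem theorem2p6 (q α β : ℝ) (hq0 : 0 < q) (hq1 : q < 1)
    (hα0 : 0 < α * q) (hα1 : α * q < 1) (hβ0 : 0 < β * q) (hβ1 : β * q < 1)
    (k m N n : ℕ) (hn : n ≤ N) :
    (1 < α → k < n →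
      QHahn.QuasiOrthogonal q α β N (QHahn.qHahn q (α / q ^ k) β N n) n k ∧
      n - k ≤ (QHahn.zerosIn q N (QHahn.qHahn q (α / q ^ k) β N n)).ncard) ∧
    (1 < β → m < n →
      QHahn.QuasiOrthogonal q α β N (QHahn.qHahn q α (β / q ^ m) N n) n m ∧
      n - m ≤ (QHahn.zerosIn q N (QHahn.qHahn q α (β / q ^ m) N n)).ncard) ∧
    (1 < α → 1 < β → k + m < n →
      QHahn.QuasiOrthogonal q α β N (QHahn.qHahn q (α / q ^ k) (β / q ^ m) N n) n (k + m) ∧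
      n - (k + m) ≤
        (QHahn.zerosIn q N (QHahn.qHahn q (α / q ^ k) (β / q ^ m) N n)).ncard) := by
  have hpow {c : ℝ} (hc : 1 < c) (l i : ℕ) (_ : i < l) : c ≠ q ^ i :=
    ((pow_le_one₀ hq0.le hq1.le).trans_lt hc).ne'
  refine ⟨fun hα hk => ?_, fun hβ hm => ?_, fun hα hβ hkm => ?_⟩
  · simpa using theorem2p6_general hq0 hq1 hα0 hα1 hβ0 hβ1 hn (hpow hα k) (m := 0) (by simp) hk
  · simpa using theorem2p6_general hq0 hq1 hα0 hα1 hβ0 hβ1 hn (k := 0) (by simp) (hpow hβ m)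
      (by simpa using hm)
  · exact theorem2p6_general hq0 hq1 hα0 hα1 hβ0 hβ1 hn (hpow hα k) (hpow hβ m) hkm
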